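/- For a Riemannian metric $g$ on the sphere $S^n$, a closed curve is a continuous map $\alpha:\mathbb R/\mathbb Z\to S^n$; its length is its total variation with respect to the Riemannian distance of $g$ (possibly $\infty$), and $2\alpha$ denotes the closed curve $s\mapsto\alpha(2s)$, that is, $\alpha$ traversed twice. For $L>0$ and a closed curve $\alpha$ of length at most $L$, let $$[\alpha]_L=\inf\{\operatorname{length}(\beta)\;:\;\beta \text{ is freely homotopic to } \alpha \text{ through closed curves of length at most } L\}.$$ **Proposition.** For every pair of real numbers $K>L>0$ and every integer $n\ge 4$ there exist a smooth Riemannian metric on $S^n$ and a closed curve $\alpha$ on $S^n$ such that $2\alpha$ has length at most $L$, $\alpha$ has length at most $K$, and $$[2\alpha]_L=0\qquad\text{and}\qquad[\alpha]_K>0 .$$ -/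

import Mathlib

open scoped Manifold ContDiff ENNReal Bundle

noncomputable section

/-- The length of a closed curve `γ : ℝ/ℤ → M` in the Riemannian manifold `(M, g)`: the total
variation of `γ` over one period, with respect to the Riemannian distance of `g` (the infimum of the
`g`-lengths of `C¹` paths). It is `∞` when `γ` is not rectifiable. -/
def curveLength {E : Type*} [NormedAddCommGroup E] [NormedSpace ℝ E]
    {H : Type*} [TopologicalSpace H] {I : ModelWithCorners ℝ E H}
    {M : Type*} [TopologicalSpace M] [ChartedSpace H M] [IsManifold I ∞ M] [RegularSpace M]
    (g : Bundle.ContMDiffRiemannianMetric I ∞ E (fun x : M => TangentSpace I x))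
    (γ : C(UnitAddCircle, M)) : ℝ≥0∞ :=
  letI : Bundle.RiemannianBundle (fun x : M => TangentSpace I x) := ⟨g.toRiemannianMetric⟩
  haveI : IsManifold I 1 M := IsManifold.of_le (n := ∞) (by simp)
  haveI : IsContinuousRiemannianBundle E (fun x : M => TangentSpace I x) :=
    ⟨⟨g.inner, g.contMDiff.continuous, fun _ _ _ => rfl⟩⟩
  letI : PseudoEMetricSpace M := PseudoEMetricSpace.ofRiemannianMetric I M
  eVariationOn (fun t : ℝ => γ (t : UnitAddCircle)) (Set.Icc 0 1)

/-- The closed curve `2γ`: the curve `γ` traversed twice. -/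
def doubleCurve {M : Type*} [TopologicalSpace M] (γ : C(UnitAddCircle, M)) : C(UnitAddCircle, M) where
  toFun s := γ (2 • s)
  continuous_toFun := γ.continuous.comp (continuous_const_smul 2)

/-- `β` is (freely) homotopic to `α` through closed curves of `g`-length at most `L`. -/
def HomotopicThrough {E : Type*} [NormedAddCommGroup E] [NormedSpace ℝ E]
    {H : Type*} [TopologicalSpace H] {I : ModelWithCorners ℝ E H}
    {M : Type*} [TopologicalSpace M] [ChartedSpace H M] [IsManifold I ∞ M] [RegularSpace M]
    (g : Bundle.ContMDiffRiemannianMetric I ∞ E (fun x : M => TangentSpace I x))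
    (L : ℝ) (α β : C(UnitAddCircle, M)) : Prop :=
  ∃ F : α.Homotopy β, ∀ t : unitInterval, curveLength g (F.curry t) ≤ ENNReal.ofReal L

/-- The quantity `[α]_L`: the infimum of the lengths of the closed curves that are homotopic to `α`
through closed curves of length at most `L`. It is meant for `α` of length at most `L`. -/
def minLength {E : Type*} [NormedAddCommGroup E] [NormedSpace ℝ E]
    {H : Type*} [TopologicalSpace H] {I : ModelWithCorners ℝ E H}
    {M : Type*} [TopologicalSpace M] [ChartedSpace H M] [IsManifold I ∞ M] [RegularSpace M]
    (g : Bundle.ContMDiffRiemannianMetric I ∞ E (fun x : M => TangentSpace I x))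
    (L : ℝ) (α : C(UnitAddCircle, M)) : ℝ≥0∞ :=
  ⨅ (β : C(UnitAddCircle, M)) (_ : HomotopicThrough g L α β), curveLength g β

end

/-!
The first five coordinates of a point of the sphere `S^n`, `n ≥ 4`, are read as a traceless symmetric
real `3 × 3` matrix. The unit vectors `v` of `ℝ³` give, up to scale, the matrices `3 v vᵀ - I`, which
form the Veronese surface: a projective plane in `S⁴ ⊆ S^n`, on which the determinant equals `2`. The
curve `α` is a line of this projective plane. Traversed twice, it contracts within the surface.

The metric is induced by the immersion `x ↦ (ε x, C (2 - det x)² x)` (`stretch`). On the Veronese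
surface the second component vanishes, so curves there have `ε` times their Euclidean length, and a
small `ε` makes `2α` and its contraction short (`curveLength_le_of_eq_veronesePoint`, `contraction`).
Near the level `det = 1` a large `C` makes all distances large (`norm_sub_le_of_formDet_eq_one`).

That `α` cannot shrink is seen from a double cover. A traceless form with positive determinant has
exactly one positive eigenvalue, so the vectors on which it is positive form two opposite convex
nappes (`polar_ne_zero`, `polar_pos_trans`). A loop of such forms is odd if following a nappe around
the loop interchanges the two (`IsOdd`). The curve `α` is odd (`isOdd_veroneseLine`), while a loop of
small diameter in `det ≥ 1` is even, since one vector is positive on all of it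
(`exists_ball_polar_pos`, `IsOdd.not_forall_polar_pos`). Parity is constant along homotopies within
`det > 0`. A loop of length at most `K` that touches the level `det = 1` has small Euclidean diameter,
hence is even; so a homotopy of `α` through loops of length at most `K` never reaches that level, and
all its loops are odd (`isOdd_of_homotopy`). Odd loops in `det > 1` have length bounded below
(`minLength_veroneseLine_pos`).
-/

open Bundle Set Filter Topology Bornology Manifold

/-! ### The metric induced by an immersion into a Euclidean space -/

section Pullback

variable {E : Type*} [NormedAddCommGroup E] [NormedSpace ℝ E] [FiniteDimensional ℝ E]
  {H : Type*} [TopologicalSpace H] {I : ModelWithCorners ℝ E H}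
  {M : Type*} [TopologicalSpace M] [ChartedSpace H M] [IsManifold I ∞ M]
  {F : Type*} [NormedAddCommGroup F] [InnerProductSpace ℝ F]

/-- The bilinear form `(v, w) ↦ ⟪df v, df w⟫` induced by `f : M → F` on the tangent space at `x`. It is
built on the model space `E`, to which `TangentSpace I x` unfolds, because the tangent space itself
carries no norm. -/
noncomputable def pullbackForm (f : M → F) (x : M) :
    TangentSpace I x →L[ℝ] TangentSpace I x →L[ℝ] ℝ :=
  letI D : E →L[ℝ] F := mvfderiv I f x
  letI B : E →L[ℝ] E →L[ℝ] ℝ := (innerSL ℝ (E := F)).bilinearComp D D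
  B

omit [FiniteDimensional ℝ E] [IsManifold I ∞ M] in
lemma pullbackForm_apply (f : M → F) (x : M) (v w : TangentSpace I x) :
    pullbackForm f x v w = inner ℝ (mvfderiv I f x v) (mvfderiv I f x w) := rfl

omit [IsManifold I ∞ M] in
/-- An injective linear map out of a finite-dimensional space is bounded below, so the unit ball of
the induced form is bounded. -/
lemma isVonNBounded_pullbackForm (f : M → F) (x : M)
    (hinj : Function.Injective (mvfderiv I f x)) :
    IsVonNBounded ℝ {v : TangentSpace I x | pullbackForm f x v v < 1} := by
  let D : E →L[ℝ] F := mvfderiv I f x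
  change IsVonNBounded ℝ {v : E | inner ℝ (D v) (D v) < 1}
  obtain ⟨K, hK, hD⟩ := D.toLinearMap.exists_antilipschitzWith (LinearMap.ker_eq_bot.2 hinj)
  refine (NormedSpace.isVonNBounded_ball ℝ E (K * 2)).subset fun v hv => ?_
  have h1 : ‖D v‖ < 1 := by
    have : ‖D v‖ ^ 2 < 1 := by rw [← real_inner_self_eq_norm_sq]; exact hv
    nlinarith [norm_nonneg (D v)]
  have h2 : ‖v‖ ≤ K * ‖D v‖ := by
    have := hD.le_mul_dist v 0
    simpa using this
  have h3 : (0 : ℝ) < K := by exact_mod_cast hK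
  rw [Metric.mem_ball, dist_zero_right]
  nlinarith

omit [FiniteDimensional ℝ E] in
/-- In the trivialization at `x₀` the induced form is the image of the derivative of `f`, read in
tangent coordinates, under the polynomial map `D ↦ ⟪D ·, D ·⟫`. -/
lemma contMDiff_pullbackForm (f : M → F) (hf : ContMDiff I 𝓘(ℝ, F) ∞ f) :
    ContMDiff I (I.prod 𝓘(ℝ, E →L[ℝ] E →L[ℝ] ℝ)) ∞
      (fun x : M => TotalSpace.mk' (E →L[ℝ] E →L[ℝ] ℝ)
        (E := fun x : M => TangentSpace I x →L[ℝ] TangentSpace I x →L[ℝ] ℝ) x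
        (pullbackForm f x)) := by
  intro x₀
  rw [contMDiffAt_section]
  have h1 : ContMDiffAt I 𝓘(ℝ, E →L[ℝ] F) ∞
      (inTangentCoordinates I 𝓘(ℝ, F) id f (mfderiv I 𝓘(ℝ, F) f) x₀) x₀ :=
    (hf x₀).mfderiv_const (by simp)
  have h2 : ContDiff ℝ ∞ (fun D : E →L[ℝ] F => (innerSL ℝ (E := F)).bilinearComp D D) := by
    have h3 : (fun D : E →L[ℝ] F => (innerSL ℝ (E := F)).bilinearComp D D) = fun D =>
      (((ContinuousLinearMap.compL ℝ E F ℝ).flip D).comp ((innerSL ℝ (E := F)).comp D)) := by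
      ext D v w
      simp
    rw [h3]
    fun_prop
  refine (h2.contMDiff.contMDiffAt.comp x₀ h1).congr_of_eventuallyEq ?_
  have hx₀ : ∀ᶠ x in 𝓝 x₀, x ∈ (trivializationAt E (TangentSpace I) x₀).baseSet :=
    (trivializationAt E (TangentSpace I) x₀).open_baseSet.mem_nhds
      (FiberBundle.mem_baseSet_trivializationAt' x₀)
  filter_upwards [hx₀] with x hx
  simp only [hom_trivializationAt_apply]
  ext v w
  simp only [ContinuousLinearMap.inCoordinates, ContinuousLinearMap.comp_apply]
  rw [Trivialization.continuousLinearMapAt_apply, Trivialization.linearMapAt_apply, if_pos]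
  · simp [hom_trivializationAt_apply, ContinuousLinearMap.inCoordinates,
      inTangentCoordinates, pullbackForm_apply]
    rfl
  · exact ⟨hx, mem_univ x⟩

/-- The smooth Riemannian metric on `M` induced by an immersion `f : M → F` into an inner product
space. -/
noncomputable def pullbackMetric (f : M → F) (hf : ContMDiff I 𝓘(ℝ, F) ∞ f)
    (hinj : ∀ x, Function.Injective (mvfderiv I f x)) :
    ContMDiffRiemannianMetric I ∞ E (fun x : M => TangentSpace I x) where
  inner x := pullbackForm f x
  symm x v w := by simp only [pullbackForm_apply, real_inner_comm]
  pos x v hv := by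
    rw [pullbackForm_apply, real_inner_self_pos]
    intro h
    exact hv (hinj x (by simpa using h))
  isVonNBounded x := isVonNBounded_pullbackForm f x (hinj x)
  contMDiff := contMDiff_pullbackForm f hf

/-- The Riemannian distance of the metric `g`. -/
noncomputable def metricEDist
    (g : ContMDiffRiemannianMetric I ∞ E (fun x : M => TangentSpace I x)) (x y : M) : ℝ≥0∞ :=
  letI : RiemannianBundle (fun x : M => TangentSpace I x) := ⟨g.toRiemannianMetric⟩
  riemannianEDist I x y

variable {f : M → F} {hf : ContMDiff I 𝓘(ℝ, F) ∞ f}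
    {hinj : ∀ x, Function.Injective (mvfderiv I f x)}

lemma enorm_pullbackMetric (x : M) (v : TangentSpace I x) :
    letI : RiemannianBundle (fun x : M => TangentSpace I x) :=
      ⟨(pullbackMetric f hf hinj).toRiemannianMetric⟩
    ‖v‖ₑ = ‖mvfderiv I f x v‖ₑ := by
  let : RiemannianBundle (fun x : M => TangentSpace I x) :=
      ⟨(pullbackMetric f hf hinj).toRiemannianMetric⟩
  have h : ‖v‖ = ‖mvfderiv I f x v‖ := by
    rw [norm_eq_sqrt_real_inner, norm_eq_sqrt_real_inner]
    rfl
  rw [← ofReal_norm, ← ofReal_norm, h]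

lemma pathELength_pullbackMetric {c : ℝ → M} {a b : ℝ} (hc : ContMDiffOn 𝓘(ℝ, ℝ) I 1 c (Icc a b)) :
    letI : RiemannianBundle (fun x : M => TangentSpace I x) :=
      ⟨(pullbackMetric f hf hinj).toRiemannianMetric⟩
    pathELength I c a b = ∫⁻ t in Ioo a b, ‖deriv (f ∘ c) t‖ₑ := by
  let : RiemannianBundle (fun x : M => TangentSpace I x) :=
      ⟨(pullbackMetric f hf hinj).toRiemannianMetric⟩
  rw [pathELength_eq_lintegral_mfderiv_Ioo]
  refine MeasureTheory.setLIntegral_congr_fun measurableSet_Ioo fun t ht => ?_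
  simp only [enorm_pullbackMetric]
  have h1 : MDifferentiableAt 𝓘(ℝ, ℝ) I c t :=
    (hc.contMDiffAt (Icc_mem_nhds ht.1 ht.2)).mdifferentiableAt one_ne_zero
  have h2 : MDifferentiableAt I 𝓘(ℝ, F) f (c t) := hf.mdifferentiableAt (by simp)
  have h3 := mfderiv_comp t h2 h1
  rw [mfderiv_eq_fderiv] at h3
  rw [← fderiv_apply_one_eq_deriv, h3]
  rfl

/-- An immersion does not increase distances, for the metric it induces. -/
lemma edist_le_metricEDist (x y : M) :
    edist (f x) (f y) ≤ metricEDist (pullbackMetric f hf hinj) x y := by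
  let : RiemannianBundle (fun x : M => TangentSpace I x) :=
      ⟨(pullbackMetric f hf hinj).toRiemannianMetric⟩
  refine le_of_forall_gt fun r hr => ?_
  obtain ⟨c, rfl, rfl, hc, hlt⟩ := exists_lt_of_riemannianEDist_lt (I := I) hr
  refine lt_of_le_of_lt ?_ hlt
  rw [pathELength_pullbackMetric hc]
  have h : ContDiffOn ℝ 1 (f ∘ c) (Icc 0 1) :=
    contMDiffOn_iff_contDiffOn.1 ((hf.of_le (by simp)).comp_contMDiffOn hc)
  rw [edist_comm, edist_eq_enorm_sub]
  refine (enorm_sub_le_lintegral_derivWithin_Icc_of_contDiffOn_Icc h zero_le_one).trans_eq ?_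
  rw [← MeasureTheory.restrict_Ioo_eq_restrict_Icc]
  refine MeasureTheory.setLIntegral_congr_fun measurableSet_Ioo fun t ht => ?_
  simp only [derivWithin_of_mem_nhds (Icc_mem_nhds ht.1 ht.2)]

/-- The induced metric measures a `C¹` curve by the speed of its image under `f`. -/
lemma metricEDist_le {c : ℝ → M} (hc : ContMDiff 𝓘(ℝ, ℝ) I 1 c) {N : NNReal}
    (hN : LipschitzWith N (f ∘ c)) {s t : ℝ} (hst : s ≤ t) :
    metricEDist (pullbackMetric f hf hinj) (c s) (c t) ≤ N * edist s t := by
  let : RiemannianBundle (fun x : M => TangentSpace I x) :=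
      ⟨(pullbackMetric f hf hinj).toRiemannianMetric⟩
  refine (riemannianEDist_le_pathELength (I := I) hc.contMDiffOn rfl rfl hst).trans ?_
  rw [pathELength_pullbackMetric hc.contMDiffOn]
  calc ∫⁻ u in Ioo s t, ‖deriv (f ∘ c) u‖ₑ ≤ ∫⁻ u in Ioo s t, N := by
        refine MeasureTheory.lintegral_mono fun u => ?_
        rw [enorm_le_coe]
        exact norm_deriv_le_of_lipschitz hN
    _ = N * edist s t := by
        rw [MeasureTheory.setLIntegral_const, Real.volume_Ioo, edist_comm, edist_dist,
          Real.dist_eq, abs_of_nonneg (sub_nonneg.2 hst)]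

variable [RegularSpace M]

lemma edist_le_curveLength (γ : C(UnitAddCircle, M)) {s t : ℝ} (hs : s ∈ Icc (0 : ℝ) 1)
    (ht : t ∈ Icc (0 : ℝ) 1) :
    edist (f (γ s)) (f (γ t)) ≤ curveLength (pullbackMetric f hf hinj) γ := by
  let : RiemannianBundle (fun x : M => TangentSpace I x) :=
    ⟨(pullbackMetric f hf hinj).toRiemannianMetric⟩
  have : IsManifold I 1 M := IsManifold.of_le (n := ∞) (by simp)
  have : IsContinuousRiemannianBundle E (fun x : M => TangentSpace I x) :=
    ⟨⟨(pullbackMetric f hf hinj).inner, (pullbackMetric f hf hinj).contMDiff.continuous,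
      fun _ _ _ => rfl⟩⟩
  let : PseudoEMetricSpace M := PseudoEMetricSpace.ofRiemannianMetric I M
  exact (edist_le_metricEDist (hf := hf) (hinj := hinj) _ _).trans
    (eVariationOn.edist_le (fun t : ℝ => γ (t : UnitAddCircle)) hs ht)

lemma curveLength_le (γ : C(UnitAddCircle, M)) {c : ℝ → M} (hγ : ∀ t : ℝ, γ t = c t)
    (hc : ContMDiff 𝓘(ℝ, ℝ) I 1 c) {N : NNReal} (hN : LipschitzWith N (f ∘ c)) :
    curveLength (pullbackMetric f hf hinj) γ ≤ N := by
  let : RiemannianBundle (fun x : M => TangentSpace I x) :=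
    ⟨(pullbackMetric f hf hinj).toRiemannianMetric⟩
  have : IsManifold I 1 M := IsManifold.of_le (n := ∞) (by simp)
  have : IsContinuousRiemannianBundle E (fun x : M => TangentSpace I x) :=
    ⟨⟨(pullbackMetric f hf hinj).inner, (pullbackMetric f hf hinj).contMDiff.continuous,
      fun _ _ _ => rfl⟩⟩
  let : PseudoEMetricSpace M := PseudoEMetricSpace.ofRiemannianMetric I M
  change eVariationOn (fun t : ℝ => γ (t : UnitAddCircle)) (Icc 0 1) ≤ N
  simp only [hγ]
  have h1 : LipschitzWith N c := by
    intro s t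
    rcases le_total s t with h | h
    · exact metricEDist_le (hf := hf) (hinj := hinj) hc hN h
    · rw [edist_comm, edist_comm s t]
      exact metricEDist_le (hf := hf) (hinj := hinj) hc hN h
  calc eVariationOn (c ∘ id) (Icc 0 1) ≤ N * eVariationOn (id : ℝ → ℝ) (Icc 0 1) :=
        (h1.lipschitzOnWith (s := univ)).comp_eVariationOn_le (mapsTo_univ _ _)
    _ ≤ N * ENNReal.ofReal (1 - 0) := by
        gcongr
        have := (monotone_id (α := ℝ)).monotoneOn (Icc 0 1) |>.eVariationOn_eq
          (left_mem_Icc.2 zero_le_one) (right_mem_Icc.2 zero_le_one)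
        simp
    _ = N := by simp

lemma curveLength_const (x : M) :
    curveLength (pullbackMetric f hf hinj) (ContinuousMap.const _ x) = 0 := by
  have h := curveLength_le (hf := hf) (hinj := hinj) (ContinuousMap.const _ x)
    (c := fun _ => x) (N := 0) (fun _ => rfl) contMDiff_const (LipschitzWith.const _)
  simpa using h

end Pullback

/-! ### Traceless quadratic forms in three variables -/

section Forms

/-- The symmetric bilinear form on `ℝ³` with matrix
`!![√3 x₀ + x₁, √3 x₂, √3 x₃; √3 x₂, -√3 x₀ + x₁, √3 x₄; √3 x₃, √3 x₄, -2 x₁]`. The factors `√3` make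
`x` an orthogonal coordinate system, up to scale, on the traceless symmetric matrices with the
Frobenius norm. -/
noncomputable def polar (x : Fin 5 → ℝ) (v w : Fin 3 → ℝ) : ℝ :=
  (√3 * x 0 + x 1) * (v 0 * w 0) + (-√3 * x 0 + x 1) * (v 1 * w 1) - 2 * x 1 * (v 2 * w 2)
    + √3 * x 2 * (v 0 * w 1 + v 1 * w 0) + √3 * x 3 * (v 0 * w 2 + v 2 * w 0)
    + √3 * x 4 * (v 1 * w 2 + v 2 * w 1)

/-- The determinant of the matrix of `polar x`. -/
noncomputable def formDet (x : Fin 5 → ℝ) : ℝ :=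
  (√3 * x 0 + x 1) * (-√3 * x 0 + x 1) * (-2 * x 1) + 2 * (√3 * x 2) * (√3 * x 3) * (√3 * x 4)
    - (√3 * x 0 + x 1) * (√3 * x 4) ^ 2 - (-√3 * x 0 + x 1) * (√3 * x 3) ^ 2
    + 2 * x 1 * (√3 * x 2) ^ 2

/-- The determinant of the Gram matrix of `v, w, u` for the form `polar x` is the determinant of the
form times the square of the triple product of `v, w, u`. -/
lemma gram_det (x : Fin 5 → ℝ) (v w u : Fin 3 → ℝ) :
    (u 0 * (v 1 * w 2 - v 2 * w 1) + u 1 * (v 2 * w 0 - v 0 * w 2)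
      + u 2 * (v 0 * w 1 - v 1 * w 0)) ^ 2 * formDet x
    = polar x v v * polar x w w * polar x u u + 2 * polar x v w * polar x w u * polar x v u
      - polar x v u ^ 2 * polar x w w - polar x w u ^ 2 * polar x v v
      - polar x v w ^ 2 * polar x u u := by
  unfold polar formDet
  ring

/-- The trace, which vanishes, computed in the plane of `v, w` and along its normal `v × w`. -/
lemma polar_cross (x : Fin 5 → ℝ) (v w : Fin 3 → ℝ) :
    polar x (crossProduct v w) (crossProduct v w)
    = 2 * polar x v w * (v 0 * w 0 + v 1 * w 1 + v 2 * w 2)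
      - polar x v v * (w 0 ^ 2 + w 1 ^ 2 + w 2 ^ 2)
      - polar x w w * (v 0 ^ 2 + v 1 ^ 2 + v 2 ^ 2) := by
  simp only [polar, cross_apply, Matrix.cons_val]
  ring

lemma polar_comm (x : Fin 5 → ℝ) (v w : Fin 3 → ℝ) : polar x v w = polar x w v := by
  unfold polar; ring

lemma polar_add_right (x : Fin 5 → ℝ) (v w w' : Fin 3 → ℝ) :
    polar x v (w + w') = polar x v w + polar x v w' := by
  simp only [polar, Pi.add_apply]; ring

lemma polar_smul_right (x : Fin 5 → ℝ) (v w : Fin 3 → ℝ) (c : ℝ) :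
    polar x v (c • w) = c * polar x v w := by
  simp only [polar, Pi.smul_apply, smul_eq_mul]; ring

lemma polar_add_left (x : Fin 5 → ℝ) (v v' w : Fin 3 → ℝ) :
    polar x (v + v') w = polar x v w + polar x v' w := by
  simp only [polar, Pi.add_apply]; ring

lemma polar_smul_left (x : Fin 5 → ℝ) (v w : Fin 3 → ℝ) (c : ℝ) :
    polar x (c • v) w = c * polar x v w := by
  simp only [polar, Pi.smul_apply, smul_eq_mul]; ring

lemma polar_neg_neg (x : Fin 5 → ℝ) (v w : Fin 3 → ℝ) : polar x (-v) (-w) = polar x v w := by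
  simp only [polar, Pi.neg_apply]; ring

@[fun_prop]
lemma Continuous.polar {T : Type*} [TopologicalSpace T] {x : T → Fin 5 → ℝ} {v w : T → Fin 3 → ℝ}
    (hx : Continuous x) (hv : Continuous v) (hw : Continuous w) :
    Continuous fun t => polar (x t) (v t) (w t) := by
  unfold _root_.polar
  fun_prop

@[fun_prop]
lemma continuous_formDet : Continuous formDet := by
  unfold formDet
  fun_prop

lemma sum_sq_pos_of_polar_pos {x : Fin 5 → ℝ} {v : Fin 3 → ℝ} (hv : 0 < polar x v v) :
    0 < v 0 ^ 2 + v 1 ^ 2 + v 2 ^ 2 := by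
  by_contra! hc
  have e0 : v 0 = 0 := by nlinarith only [hc, sq_nonneg (v 0), sq_nonneg (v 1), sq_nonneg (v 2)]
  have e1 : v 1 = 0 := by nlinarith only [hc, sq_nonneg (v 0), sq_nonneg (v 1), sq_nonneg (v 2)]
  have e2 : v 2 = 0 := by nlinarith only [hc, sq_nonneg (v 0), sq_nonneg (v 1), sq_nonneg (v 2)]
  simp [polar, e0, e1, e2] at hv

/-- A traceless form of nonnegative determinant is not positive definite on any plane. If
`polar x v w = 0`, then the form is positive definite on the plane of `v, w`, so by tracelessness it
is negative on `v × w`; the Gram determinant of `v, w, v × w` is then negative. -/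
lemma polar_ne_zero {x : Fin 5 → ℝ} (hx : 0 ≤ formDet x) {v w : Fin 3 → ℝ}
    (hv : 0 < polar x v v) (hw : 0 < polar x w w) : polar x v w ≠ 0 := by
  intro h
  have h1 := gram_det x v w (crossProduct v w)
  have h2 := polar_cross x v w
  have hv0 := sum_sq_pos_of_polar_pos hv
  have hw0 := sum_sq_pos_of_polar_pos hw
  have hu : polar x (crossProduct v w) (crossProduct v w) < 0 := by
    rw [h2, h]
    have := mul_pos hv hw0
    have := mul_pos hw hv0
    linarith
  rw [h] at h1
  have h3 := mul_pos (mul_pos hv hw) (neg_pos.2 hu)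
  have h4 := mul_nonneg (sq_nonneg (polar x v (crossProduct v w))) hw.le
  have h5 := mul_nonneg (sq_nonneg (polar x w (crossProduct v w))) hv.le
  have h6 := mul_nonneg (sq_nonneg (crossProduct v w 0 * (v 1 * w 2 - v 2 * w 1)
    + crossProduct v w 1 * (v 2 * w 0 - v 0 * w 2)
    + crossProduct v w 2 * (v 0 * w 1 - v 1 * w 0))) hx
  nlinarith only [h1, h3, h4, h5, h6]

/-- The positive cone `{v | 0 < polar x v v}` consists of two opposite nappes, on each of which the
form pairs positively. -/
lemma polar_pos_trans {x : Fin 5 → ℝ} (hx : 0 ≤ formDet x) {u v w : Fin 3 → ℝ}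
    (hu : 0 < polar x u u) (hv : 0 < polar x v v) (hw : 0 < polar x w w)
    (huv : 0 < polar x u v) (hvw : 0 < polar x v w) : 0 < polar x u w := by
  refine lt_of_le_of_ne ?_ (polar_ne_zero hx hu hw).symm
  by_contra! hneg
  -- the point of the segment from `v` to `w` (up to scale) that is orthogonal to `u`
  refine polar_ne_zero hx hu (w := polar x u v • w + (-polar x u w) • v) ?_ ?_
  · have h : 0 < -polar x u w := neg_pos.2 hneg
    simp only [polar_add_right, polar_smul_right, polar_add_left, polar_smul_left,
      polar_comm x w v]
    positivity
  · simp only [polar_add_right, polar_smul_right]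
    ring

lemma exists_polar_pos {x : Fin 5 → ℝ} (hx : 0 < formDet x) : ∃ v, 0 < polar x v v := by
  by_contra! h
  have h3 : (0 : ℝ) < √3 := by positivity
  have a0 := h ![1, 0, 0]
  have a1 := h ![0, 1, 0]
  have a2 := h ![0, 0, 1]
  have b0 := h ![1, 1, 0]
  have b1 := h ![1, -1, 0]
  have c0 := h ![1, 0, 1]
  have c1 := h ![1, 0, -1]
  have d0 := h ![0, 1, 1]
  have d1 := h ![0, 1, -1]
  simp [polar] at a0 a1 a2 b0 b1 c0 c1 d0 d1
  have e1 : x 1 = 0 := by linarith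
  have e0 : √3 * x 0 = 0 := by linarith
  have e2 : √3 * x 2 = 0 := by linarith
  have e3 : √3 * x 3 = 0 := by linarith
  have e4 : √3 * x 4 = 0 := by linarith
  simp [formDet, e0, e1, e2, e3, e4] at hx

end Forms

/-! ### The parity of a loop of forms of positive determinant -/

section Parity

lemma pos_of_ne_zero_of_pos {g : ℝ → ℝ} {p q : ℝ} (hg : ContinuousOn g (Icc p q))
    (h0 : ∀ s ∈ Icc p q, g s ≠ 0) {r : ℝ} (hr : r ∈ Icc p q) (hpos : 0 < g r) :
    ∀ s ∈ Icc p q, 0 < g s := by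
  intro s hs
  by_contra! hneg
  obtain ⟨z, hz, hz0⟩ := isPreconnected_Icc.intermediate_value hs hr hg ⟨hneg, hpos.le⟩
  exact h0 z hz hz0

/-- A continuous choice of a vector in the positive cone of each form of the path `A`, over `[0, 1]`. -/
def IsSection (A : ℝ → Fin 5 → ℝ) (v : ℝ → Fin 3 → ℝ) : Prop :=
  Continuous v ∧ ∀ s ∈ Icc (0 : ℝ) 1, 0 < polar (A s) (v s) (v s)

/-- Paths lift to the positive cones: cover `[0, 1]` by intervals on which a constant vector is
positive, and interpolate between consecutive vectors chosen in the same nappe. -/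
lemma exists_isSection {A : ℝ → Fin 5 → ℝ} (hA : Continuous A)
    (hpos : ∀ s ∈ Icc (0 : ℝ) 1, 0 < formDet (A s)) : ∃ v, IsSection A v := by
  obtain ⟨δ, hδ, hcov⟩ := lebesgue_number_lemma_of_metric (isCompact_Icc (a := (0 : ℝ)) (b := 1))
    (c := fun w : Fin 3 → ℝ => {s | 0 < polar (A s) w w})
    (fun w => isOpen_lt continuous_const (by fun_prop))
    (fun s hs => mem_iUnion.2 (exists_polar_pos (hpos s hs)))
  set η := δ / 2 with hη
  have hη0 : 0 < η := by positivity
  have key : ∀ k : ℕ, ∃ v : ℝ → Fin 3 → ℝ, Continuous v ∧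
      ∀ s ∈ Icc (0 : ℝ) 1, s ≤ k * η → 0 < polar (A s) (v s) (v s) := by
    intro k
    induction k with
    | zero =>
      obtain ⟨w, hw⟩ := exists_polar_pos (hpos 0 (by simp))
      refine ⟨fun _ => w, continuous_const, fun s hs hs0 => ?_⟩
      have : s = 0 := le_antisymm (by simpa using hs0) hs.1
      rwa [this]
    | succ k ih =>
      obtain ⟨v, hv, hvpos⟩ := ih
      by_cases hk : 1 < k * η
      · exact ⟨v, hv, fun s hs _ => hvpos s hs (hs.2.trans hk.le)⟩
      push Not at hk
      have hmem : k * η ∈ Icc (0 : ℝ) 1 := ⟨by positivity, hk⟩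
      obtain ⟨w, hw⟩ := hcov (k * η) hmem
      have hw' : ∀ s, k * η - δ < s → s < k * η + δ → 0 < polar (A s) w w := fun s h1 h2 =>
        hw (by rw [Metric.mem_ball, Real.dist_eq, abs_lt]; constructor <;> linarith)
      obtain ⟨w, hw, hvw⟩ : ∃ w, (∀ s, k * η - δ < s → s < k * η + δ → 0 < polar (A s) w w) ∧
          0 < polar (A (k * η)) (v (k * η)) w := by
        rcases (polar_ne_zero (hpos _ hmem).le (hvpos _ hmem le_rfl)
          (hw' _ (by linarith) (by linarith))).lt_or_gt with h | h
        · refine ⟨-w, fun s h1 h2 => by rw [polar_neg_neg]; exact hw' s h1 h2, ?_⟩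
          have := polar_smul_right (A (k * η)) (v (k * η)) w (-1)
          rw [neg_one_smul] at this
          linarith
        · exact ⟨w, hw', h⟩
      have hpq : ∀ s ∈ Icc (max 0 (k * η - η)) (k * η), 0 < polar (A s) (v s) w := by
        refine pos_of_ne_zero_of_pos (by fun_prop) (fun s hs => ?_)
          (right_mem_Icc.2 (max_le hmem.1 (by linarith))) hvw
        obtain ⟨h1, h2⟩ := hs
        rw [max_le_iff] at h1
        have hs1 : s ∈ Icc (0 : ℝ) 1 := ⟨h1.1, h2.trans hk⟩
        exact polar_ne_zero (hpos s hs1).le (hvpos s hs1 h2) (hw s (by linarith) (by linarith))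
      -- the switch from `v` to `w` takes place on `[k η - η, k η]`, where both are positive
      let χ : ℝ → ℝ := fun s => max 0 (min 1 ((s - (k * η - η)) / η))
      have hχ : Continuous χ := by fun_prop
      refine ⟨fun s => (1 - χ s) • v s + χ s • w, by fun_prop, fun s hs hsk => ?_⟩
      push_cast at hsk
      rcases le_or_gt s (k * η - η) with h1 | h1
      · have : χ s = 0 := by
          apply max_eq_left
          exact (min_le_right _ _).trans (div_nonpos_of_nonpos_of_nonneg (by linarith) hη0.le)
        simp only [this, sub_zero, one_smul, zero_smul, add_zero]
        exact hvpos s hs (by linarith)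
      have hws : 0 < polar (A s) w w := hw s (by linarith) (by linarith)
      rcases le_or_gt (k * η) s with h2 | h2
      · have : χ s = 1 := by
          have : 1 ≤ (s - (k * η - η)) / η := by rw [le_div_iff₀ hη0]; linarith
          simp [χ, min_eq_left this]
        simpa [this] using hws
      have hvs := hvpos s hs h2.le
      have hvws := hpq s ⟨max_le hs.1 h1.le, h2.le⟩
      have hχ0 : 0 ≤ χ s := le_max_left _ _
      have hχ1 : χ s ≤ 1 := max_le zero_le_one (min_le_left _ _)
      simp only [polar_add_right, polar_smul_right, polar_add_left, polar_smul_left,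
        polar_comm (A s) w (v s)]
      rcases hχ0.eq_or_lt with h | h
      · simpa [← h] using hvs
      · have : 0 ≤ 1 - χ s := by linarith
        positivity
  obtain ⟨k, hk⟩ := exists_nat_gt (1 / η)
  obtain ⟨v, hv, hvpos⟩ := key k
  rw [div_lt_iff₀ hη0] at hk
  exact ⟨v, hv, fun s hs => hvpos s hs (hs.2.trans hk.le)⟩

/-- Whether a section over a loop of forms returns to the nappe it started from does not depend on
the section. -/
lemma polar_pos_of_isSection {A : ℝ → Fin 5 → ℝ} (hA : Continuous A) (hper : A 0 = A 1)
    (hpos : ∀ s ∈ Icc (0 : ℝ) 1, 0 < formDet (A s)) {v w : ℝ → Fin 3 → ℝ}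
    (hv : IsSection A v) (hw : IsSection A w) (h : 0 < polar (A 0) (v 0) (v 1)) :
    0 < polar (A 0) (w 0) (w 1) := by
  have h0 : (0 : ℝ) ∈ Icc (0 : ℝ) 1 := by simp
  have h1 : (1 : ℝ) ∈ Icc (0 : ℝ) 1 := by simp
  have hne : ∀ s ∈ Icc (0 : ℝ) 1, polar (A s) (v s) (w s) ≠ 0 := fun s hs =>
    polar_ne_zero (hpos s hs).le (hv.2 s hs) (hw.2 s hs)
  -- changing the sign of `w` changes neither the hypotheses nor the conclusion
  wlog hvw : 0 < polar (A 0) (v 0) (w 0) generalizing w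
  · have hneg : ∀ s, polar (A s) (v s) ((-w) s) = - polar (A s) (v s) (w s) := fun s => by
      have := polar_smul_right (A s) (v s) (w s) (-1)
      rw [neg_one_smul] at this
      simpa using this
    have := this (w := -w) ⟨hw.1.neg, fun s hs => by
      simpa only [Pi.neg_apply, polar_neg_neg] using hw.2 s hs⟩
      (fun s hs => by rw [hneg]; exact neg_ne_zero.2 (hne s hs))
      (by rw [hneg]; exact neg_pos.2 (lt_of_le_of_ne (not_lt.1 hvw) (hne 0 h0)))
    simpa only [Pi.neg_apply, polar_neg_neg] using this
  have hall := pos_of_ne_zero_of_pos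
    (g := fun s => polar (A s) (v s) (w s)) (p := 0) (q := 1)
    (by have := hv.1; have := hw.1; fun_prop) hne h0 hvw
  have hv1 := hv.2 1 h1
  have hw1 := hw.2 1 h1
  have hvw1 := hall 1 h1
  simp only [← hper] at hv1 hw1 hvw1
  have hd := (hpos 0 h0).le
  refine polar_pos_trans hd (hw.2 0 h0) hv1 hw1 ?_ hvw1
  exact polar_pos_trans hd (hw.2 0 h0) (hv.2 0 h0) hv1 (by rwa [polar_comm]) h

/-- The loop of forms `A` is odd if some section over it ends in the nappe opposite to the one it
starts from. For loops of forms of positive determinant this says that the loop is not null-homotopic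
among such forms. The definition is meant for `A 0 = A 1`. -/
def IsOdd (A : ℝ → Fin 5 → ℝ) : Prop :=
  ∃ v, IsSection A v ∧ polar (A 0) (v 0) (v 1) < 0

/-- A loop in the region where one fixed vector is positive is even. -/
lemma IsOdd.not_forall_polar_pos {A : ℝ → Fin 5 → ℝ} (h : IsOdd A) (hA : Continuous A)
    (hper : A 0 = A 1) (hpos : ∀ s ∈ Icc (0 : ℝ) 1, 0 < formDet (A s)) (w : Fin 3 → ℝ) :
    ¬ ∀ s ∈ Icc (0 : ℝ) 1, 0 < polar (A s) w w := by
  intro hw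
  obtain ⟨v, hv, hneg⟩ := h
  exact (polar_pos_of_isSection hA hper hpos (v := fun _ => w) ⟨continuous_const, hw⟩ hv
    (hw 0 (by simp))).not_gt hneg

/-- Oddness persists along a homotopy of loops that starts in the region where the determinant
exceeds `1`, provided each loop of the homotopy that meets the level `1` stays where one vector is
positive. The parameters at which the loop is odd and within the region form a clopen set. -/
lemma isOdd_of_homotopy {A : unitInterval → ℝ → Fin 5 → ℝ} (hA : Continuous (Function.uncurry A))
    (hper : ∀ t, A t 0 = A t 1) (hodd : IsOdd (A 0))
    (hdisc : ∀ s ∈ Icc (0 : ℝ) 1, 1 < formDet (A 0 s))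
    (hbarrier : ∀ t, (∃ s ∈ Icc (0 : ℝ) 1, formDet (A t s) = 1) →
      ∃ w, ∀ s ∈ Icc (0 : ℝ) 1, 0 < polar (A t s) w w) (t : unitInterval) :
    IsOdd (A t) ∧ ∀ s ∈ Icc (0 : ℝ) 1, 1 < formDet (A t s) := by
  have hAt : ∀ t, Continuous (A t) := fun t => by fun_prop
  have hAs : ∀ s, Continuous fun t => A t s := fun s => by fun_prop
  have hsec : ∀ (t : unitInterval) (v : ℝ → Fin 3 → ℝ), IsSection (A t) v →
      ∀ᶠ t' in 𝓝 t, IsSection (A t') v := by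
    intro t v hv
    have : ∀ᶠ t' in 𝓝 t, ∀ s ∈ Icc (0 : ℝ) 1, 0 < polar (A t' s) (v s) (v s) := by
      refine isCompact_Icc.eventually_forall_of_forall_eventually fun s hs => ?_
      have hc : Continuous fun z : unitInterval × ℝ =>
          polar (Function.uncurry A z) (v z.2) (v z.2) := by
        have := hv.1
        fun_prop
      exact (hc.tendsto (t, s)).eventually_const_lt (hv.2 s hs)
    filter_upwards [this] with t' ht' using ⟨hv.1, ht'⟩
  let T : Set unitInterval := {t | IsOdd (A t) ∧ ∀ s ∈ Icc (0 : ℝ) 1, 1 < formDet (A t s)}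
  suffices hT : IsClopen T by
    have := hT.eq_univ ⟨0, hodd, hdisc⟩
    exact this.ge (mem_univ t)
  constructor
  · refine isClosed_of_closure_subset fun t ht => ?_
    have hge : ∀ s ∈ Icc (0 : ℝ) 1, 1 ≤ formDet (A t s) := by
      intro s hs
      have hcl : IsClosed {t | 1 ≤ formDet (A t s)} :=
        isClosed_le continuous_const (by have := hAs s; fun_prop)
      exact closure_minimal (fun t' ht' => (ht'.2 s hs).le) hcl ht
    have hpos : ∀ s ∈ Icc (0 : ℝ) 1, 0 < formDet (A t s) := fun s hs => by linarith [hge s hs]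
    obtain ⟨v, hv⟩ := exists_isSection (hAt t) hpos
    have hvt : ∃ᶠ t' in 𝓝 t, t' ∈ T := mem_closure_iff_frequently.1 ht
    have hodd : IsOdd (A t) := by
      refine ⟨v, hv, ?_⟩
      have hv1 := hv.2 1 (by simp)
      rw [← hper t] at hv1
      refine lt_of_le_of_ne ?_ (polar_ne_zero (hpos 0 (by simp)).le (hv.2 0 (by simp)) hv1)
      by_contra! hpos0
      have hc : Continuous fun t => polar (A t 0) (v 0) (v 1) := by have := hAs 0; fun_prop
      obtain ⟨t', ⟨hT, hdisc'⟩, hv', hpos'⟩ := (hvt.and_eventually ((hsec t v hv).and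
        ((hc.tendsto t).eventually_const_lt hpos0))).exists
      obtain ⟨w, hw, hneg⟩ := hT
      exact (polar_pos_of_isSection (hAt t') (hper t')
        (fun s hs => by linarith [hdisc' s hs]) hv' hw hpos').not_gt hneg
    refine ⟨hodd, fun s hs => lt_of_le_of_ne (hge s hs) fun heq => ?_⟩
    obtain ⟨w, hw⟩ := hbarrier t ⟨s, hs, heq.symm⟩
    exact hodd.not_forall_polar_pos (hAt t) (hper t) hpos w hw
  · rw [isOpen_iff_mem_nhds]
    rintro t ⟨⟨v, hv, hneg⟩, hdisc⟩
    have h1 : ∀ᶠ t' in 𝓝 t, ∀ s ∈ Icc (0 : ℝ) 1, 1 < formDet (A t' s) := by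
      refine isCompact_Icc.eventually_forall_of_forall_eventually fun s hs => ?_
      have hc : Continuous fun z : unitInterval × ℝ => formDet (Function.uncurry A z) := by fun_prop
      exact (hc.tendsto (t, s)).eventually_const_lt (hdisc s hs)
    have hc : Continuous fun t => polar (A t 0) (v 0) (v 1) := by have := hAs 0; fun_prop
    filter_upwards [h1, hsec t v hv, (hc.tendsto t).eventually_lt_const hneg] with t' h1 h2 h3
    exact ⟨⟨v, h2, h3⟩, h1⟩

end Parity

/-! ### The Veronese surface -/

section Veronese

/-- The coordinates of the traceless symmetric matrix `3 v vᵀ - |v|² I`. -/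
noncomputable def veronese (v : Fin 3 → ℝ) : Fin 5 → ℝ :=
  ![√3 * ((v 0 ^ 2 - v 1 ^ 2) / 2), (v 0 ^ 2 + v 1 ^ 2 - 2 * v 2 ^ 2) / 2, √3 * (v 0 * v 1),
    √3 * (v 0 * v 2), √3 * (v 1 * v 2)]

lemma sqrt_three_mul_self_mul (z : ℝ) : √3 * (√3 * z) = 3 * z := by
  rw [← mul_assoc, Real.mul_self_sqrt (by norm_num)]

lemma polar_veronese (v w u : Fin 3 → ℝ) :
    polar (veronese v) w u = 3 * (v ⬝ᵥ w) * (v ⬝ᵥ u) - (v ⬝ᵥ v) * (w ⬝ᵥ u) := by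
  simp only [polar, veronese, Matrix.cons_val, neg_mul, sqrt_three_mul_self_mul, dotProduct,
    Fin.sum_univ_three]
  ring

lemma formDet_veronese (v : Fin 3 → ℝ) : formDet (veronese v) = 2 * (v ⬝ᵥ v) ^ 3 := by
  simp only [formDet, veronese, Matrix.cons_val, neg_mul, sqrt_three_mul_self_mul, dotProduct,
    Fin.sum_univ_three]
  ring

lemma sum_sq_veronese_sub (v w : Fin 3 → ℝ) :
    ∑ j, (veronese v j - veronese w j) ^ 2
      = (v ⬝ᵥ v) ^ 2 + (w ⬝ᵥ w) ^ 2 - 3 * (v ⬝ᵥ w) ^ 2 + (v ⬝ᵥ v) * (w ⬝ᵥ w) := by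
  have h : √3 ^ 2 = 3 := Real.sq_sqrt (by norm_num)
  simp only [veronese, Matrix.cons_val, Fin.sum_univ_five, dotProduct, Fin.sum_univ_three,
    ← mul_sub, mul_pow, h]
  ring

lemma sum_sq_veronese (v : Fin 3 → ℝ) : ∑ j, veronese v j ^ 2 = (v ⬝ᵥ v) ^ 2 := by
  have h0 : veronese 0 = 0 := by
    ext j; fin_cases j <;> simp [veronese]
  simpa [h0] using sum_sq_veronese_sub v 0

@[fun_prop]
lemma continuous_veronese : Continuous veronese := by
  refine continuous_pi fun j => ?_
  fin_cases j <;> simp [veronese] <;> fun_prop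

@[fun_prop]
lemma contDiff_veronese : ContDiff ℝ ∞ veronese := by
  refine contDiff_pi.2 fun j => ?_
  fin_cases j <;> simp [veronese] <;> fun_prop

end Veronese

/-! ### The stretched immersion -/

section Coordinates

variable {E : Type*} [NormedAddCommGroup E] [InnerProductSpace ℝ E]

/-- The coordinates of `x` along the orthonormal family `b`. -/
noncomputable def coords (b : Fin 5 → E) (x : E) : Fin 5 → ℝ := fun j => inner ℝ (b j) x

/-- The point of the span of `b` with coordinates `y`. -/
noncomputable def embed (b : Fin 5 → E) (y : Fin 5 → ℝ) : E := ∑ j, y j • b j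

lemma coords_embed {b : Fin 5 → E} (hb : Orthonormal ℝ b) (y : Fin 5 → ℝ) :
    coords b (embed b y) = y := funext fun j => hb.inner_right_fintype y j

lemma norm_sq_embed {b : Fin 5 → E} (hb : Orthonormal ℝ b) (y : Fin 5 → ℝ) :
    ‖embed b y‖ ^ 2 = ∑ j, y j ^ 2 := by
  rw [← real_inner_self_eq_norm_sq, embed, hb.inner_sum]
  simp [sq]

lemma embed_sub (b : Fin 5 → E) (y z : Fin 5 → ℝ) : embed b y - embed b z = embed b (y - z) := by
  simp [embed, sub_smul]

@[fun_prop]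
lemma continuous_embed (b : Fin 5 → E) : Continuous (embed b) := by unfold embed; fun_prop

@[fun_prop]
lemma contDiff_embed (b : Fin 5 → E) : ContDiff ℝ ∞ (embed b) := by unfold embed; fun_prop

@[fun_prop]
lemma continuous_coords (b : Fin 5 → E) : Continuous (coords b) := by unfold coords; fun_prop

@[fun_prop]
lemma contDiff_coords (b : Fin 5 → E) : ContDiff ℝ ∞ (coords b) := by
  refine contDiff_pi.2 fun j => ?_
  exact (innerSL ℝ (b j)).contDiff

@[fun_prop]
lemma contDiff_formDet : ContDiff ℝ ∞ formDet := by unfold formDet; fun_prop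

/-- The map `x ↦ (ε x, C (2 - det x)² x)`. Its second component vanishes on the Veronese surface,
where the determinant is `2`; the exponent keeps the factor nonnegative. -/
noncomputable def stretch (b : Fin 5 → E) (ε C : ℝ) (x : E) : WithLp 2 (E × E) :=
  WithLp.toLp 2 (ε • x, (C * (2 - formDet (coords b x)) ^ 2) • x)

lemma contDiff_stretch (b : Fin 5 → E) (ε C : ℝ) : ContDiff ℝ ∞ (stretch b ε C) := by
  have h : ContDiff ℝ ∞ fun x : E => (ε • x, (C * (2 - formDet (coords b x)) ^ 2) • x) := by fun_prop
  exact (WithLp.prodContinuousLinearEquiv 2 ℝ E E).symm.contDiff.comp h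

lemma norm_sub_le_norm_stretch_sub (b : Fin 5 → E) {ε : ℝ} (hε : 0 ≤ ε) (C : ℝ) (x y : E) :
    ε * ‖x - y‖ ≤ ‖stretch b ε C x - stretch b ε C y‖ := by
  have h : ‖ε • x - ε • y‖ ≤ ‖stretch b ε C x - stretch b ε C y‖ :=
    WithLp.norm_fst_le _ (stretch b ε C x - stretch b ε C y)
  rwa [← smul_sub, norm_smul, Real.norm_of_nonneg hε] at h

/-- Across the level `det = 1`, where the factor `(2 - det x)²` is `1`, distances are stretched by at
least `C / 2`. -/
lemma norm_sub_le_of_formDet_eq_one (b : Fin 5 → E) (ε : ℝ) {C : ℝ} (hC : 0 ≤ C) {x y : E}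
    (hx : ‖x‖ = 1) (hy : ‖y‖ = 1) (hdisc : formDet (coords b x) = 1) :
    C * ‖x - y‖ ≤ 2 * ‖stretch b ε C x - stretch b ε C y‖ := by
  set a := (2 - formDet (coords b y)) ^ 2 with ha
  have ha0 : 0 ≤ a := sq_nonneg _
  have h : ‖(C * (2 - formDet (coords b x)) ^ 2) • x - (C * a) • y‖
      ≤ ‖stretch b ε C x - stretch b ε C y‖ :=
    WithLp.norm_snd_le _ (stretch b ε C x - stretch b ε C y)
  rw [hdisc, mul_smul, mul_smul, ← smul_sub, norm_smul, Real.norm_of_nonneg hC] at h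
  norm_num at h
  have hay : ‖a • y‖ = a := by rw [norm_smul, hy, Real.norm_of_nonneg ha0, mul_one]
  have h1 : |1 - a| ≤ ‖x - a • y‖ := by
    have := abs_norm_sub_norm_le x (a • y)
    rwa [hx, hay] at this
  have h2 : ‖x - y‖ ≤ ‖x - a • y‖ + |1 - a| := by
    calc ‖x - y‖ = ‖(x - a • y) + (a - 1) • y‖ := by congr 1; module
      _ ≤ ‖x - a • y‖ + ‖(a - 1) • y‖ := norm_add_le _ _
      _ = ‖x - a • y‖ + |1 - a| := by
        rw [norm_smul, hy, mul_one, Real.norm_eq_abs, abs_sub_comm]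
  nlinarith [norm_nonneg (x - y)]

lemma norm_stretch_sub_of_formDet_eq_two (b : Fin 5 → E) {ε : ℝ} (hε : 0 ≤ ε) (C : ℝ) {x y : E}
    (hx : formDet (coords b x) = 2) (hy : formDet (coords b y) = 2) :
    ‖stretch b ε C x - stretch b ε C y‖ = ε * ‖x - y‖ := by
  have h := WithLp.prod_norm_sq_eq_of_L2 (stretch b ε C x - stretch b ε C y)
  have h1 : (stretch b ε C x - stretch b ε C y).fst = ε • (x - y) := by
    simp [stretch, smul_sub]
  have h2 : (stretch b ε C x - stretch b ε C y).snd = 0 := by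
    simp [stretch, hx, hy]
  rw [h1, h2, norm_zero, norm_smul, Real.norm_of_nonneg hε] at h
  exact (pow_left_inj₀ (norm_nonneg _) (by positivity) two_ne_zero).1 (by rw [h]; ring)

end Coordinates

/-! ### Spherical coordinates on the Veronese surface -/

section LatLong

variable {E : Type*} [NormedAddCommGroup E] [InnerProductSpace ℝ E]

/-- The vector of latitude `τ` over the equatorial point `z` of the unit sphere of `ℝ³`. -/
noncomputable def latLong (τ : ℝ) (z : ℂ) : Fin 3 → ℝ :=
  ![Real.cos τ * z.re, Real.cos τ * z.im, Real.sin τ]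

lemma latLong_dotProduct (τ : ℝ) (z w : ℂ) : latLong τ z ⬝ᵥ latLong τ w =
    Real.cos τ ^ 2 * (z.re * w.re + z.im * w.im) + Real.sin τ ^ 2 := by
  simp [latLong, dotProduct, Fin.sum_univ_three]
  ring

lemma latLong_dotProduct_self (τ : ℝ) (z : Circle) : latLong τ z ⬝ᵥ latLong τ z = 1 := by
  have h : (z : ℂ).re * (z : ℂ).re + (z : ℂ).im * (z : ℂ).im = 1 := by
    rw [← Complex.normSq_apply, Circle.normSq_coe]
  rw [latLong_dotProduct, h, mul_one, Real.cos_sq_add_sin_sq]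

lemma norm_embed_veronese {b : Fin 5 → E} (hb : Orthonormal ℝ b) (τ : ℝ) (z : Circle) :
    ‖embed b (veronese (latLong τ z))‖ = 1 := by
  have h := norm_sq_embed hb (veronese (latLong τ z))
  rw [sum_sq_veronese, latLong_dotProduct_self, one_pow] at h
  exact (pow_eq_one_iff_of_nonneg (norm_nonneg _) two_ne_zero).1 h

lemma norm_embed_veronese_sub_le {b : Fin 5 → E} (hb : Orthonormal ℝ b) (τ s t : ℝ) :
    ‖embed b (veronese (latLong τ (Circle.exp s))) - embed b (veronese (latLong τ (Circle.exp t)))‖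
      ≤ 2 * |s - t| := by
  have h := norm_sq_embed hb (veronese (latLong τ (Circle.exp s))
    - veronese (latLong τ (Circle.exp t)))
  simp only [Pi.sub_apply] at h
  rw [sum_sq_veronese_sub, latLong_dotProduct_self, latLong_dotProduct_self,
    latLong_dotProduct] at h
  rw [embed_sub]
  have hre : ∀ s, (Circle.exp s : ℂ).re = Real.cos s := fun s => by
    rw [Circle.coe_exp, Complex.exp_ofReal_mul_I_re]
  have him : ∀ s, (Circle.exp s : ℂ).im = Real.sin s := fun s => by
    rw [Circle.coe_exp, Complex.exp_ofReal_mul_I_im]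
  rw [hre, hre, him, him, ← Real.cos_sub] at h
  refine (sq_le_sq₀ (norm_nonneg _) (by positivity)).1 ?_
  rw [h, mul_pow, sq_abs]
  have h1 := Real.one_sub_sq_div_two_le_cos (x := s - t)
  have h2 := Real.cos_le_one (s - t)
  have h3 := Real.cos_sq_add_sin_sq τ
  have h4 : Real.sin τ ^ 2 = 1 - Real.cos τ ^ 2 := by linarith
  have h5 : Real.cos τ ^ 2 ≤ 1 := Real.cos_sq_le_one τ
  have h6 := sq_nonneg (Real.cos τ)
  rw [h4]
  generalize Real.cos τ ^ 2 = c at *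
  generalize Real.cos (s - t) = d at *
  have h7 : c * (1 - d) ≤ 1 * (1 - d) := by gcongr
  have h8 : 0 ≤ c * (1 - d) := mul_nonneg h6 (by linarith)
  nlinarith

end LatLong

/-! ### The metric on the sphere and the two curves -/

section Sphere

variable {n : ℕ}

/-- The unit sphere of dimension `n`. -/
abbrev UnitSphere (n : ℕ) : Type := Metric.sphere (0 : EuclideanSpace ℝ (Fin (n + 1))) 1

variable {b : Fin 5 → EuclideanSpace ℝ (Fin (n + 1))}

/-- The dimension hypothesis under which Mathlib equips a unit sphere with its smooth structure. -/
lemma fact_finrank_euclideanSpace (n : ℕ) :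
    Fact (Module.finrank ℝ (EuclideanSpace ℝ (Fin (n + 1))) = n + 1) :=
  ⟨finrank_euclideanSpace_fin⟩

lemma contMDiff_stretch_coe (b : Fin 5 → EuclideanSpace ℝ (Fin (n + 1))) (ε C : ℝ) :
    ContMDiff (𝓡 n) 𝓘(ℝ, WithLp 2 (EuclideanSpace ℝ (Fin (n + 1)) × EuclideanSpace ℝ (Fin (n + 1))))
      ∞ (fun x : UnitSphere n => stretch b ε C x) :=
  have := fact_finrank_euclideanSpace n
  (contDiff_stretch b ε C).contMDiff.comp contMDiff_coe_sphere

lemma injective_mvfderiv_stretch_coe (b : Fin 5 → EuclideanSpace ℝ (Fin (n + 1))) {ε : ℝ}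
    (hε : ε ≠ 0) (C : ℝ) (x : UnitSphere n) :
    Function.Injective (mvfderiv (𝓡 n) (fun x : UnitSphere n => stretch b ε C x) x) := by
  have := fact_finrank_euclideanSpace n
  let P : WithLp 2 (EuclideanSpace ℝ (Fin (n + 1)) × EuclideanSpace ℝ (Fin (n + 1))) →L[ℝ]
      EuclideanSpace ℝ (Fin (n + 1)) := ε⁻¹ • WithLp.fstL 2 ℝ _ _
  have hP : ((↑) : UnitSphere n → EuclideanSpace ℝ (Fin (n + 1))) =
      P ∘ fun x : UnitSphere n => stretch b ε C x := by
    ext1 x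
    simp [P, stretch, smul_smul, inv_mul_cancel₀ hε]
  have h1 : MDifferentiableAt (𝓡 n) _ (fun x : UnitSphere n => stretch b ε C x) x :=
    (contMDiff_stretch_coe b ε C).mdifferentiableAt (by simp)
  intro v w hvw
  apply injective_mvfderiv_subtypeVal_sphere (n := n) x
  have h2 := mfderiv_comp x (P.mdifferentiableAt (x := stretch b ε C x)) h1
  rw [hP]
  refine (DFunLike.congr_fun h2 v).trans (Eq.trans ?_ (DFunLike.congr_fun h2 w).symm)
  exact congrArg (mfderiv _ _ P _) hvw

/-- The metric on the sphere induced by the immersion `stretch b ε C`. -/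
noncomputable def stretchMetric (b : Fin 5 → EuclideanSpace ℝ (Fin (n + 1))) {ε : ℝ}
    (hε : ε ≠ 0) (C : ℝ) : ContMDiffRiemannianMetric (𝓡 n) ∞ (EuclideanSpace ℝ (Fin n))
      (fun x : UnitSphere n => TangentSpace (𝓡 n) x) :=
  pullbackMetric (fun x : UnitSphere n => stretch b ε C x) (contMDiff_stretch_coe b ε C)
    (injective_mvfderiv_stretch_coe b hε C)

lemma norm_stretch_sub_le_of_curveLength_le {ε : ℝ} (hε : ε ≠ 0) (C : ℝ)
    {γ : C(UnitAddCircle, UnitSphere n)} {K : ℝ} (hK : 0 ≤ K)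
    (hγ : curveLength (stretchMetric b hε C) γ ≤ ENNReal.ofReal K) {s t : ℝ}
    (hs : s ∈ Icc (0 : ℝ) 1) (ht : t ∈ Icc (0 : ℝ) 1) :
    ‖stretch b ε C (γ s) - stretch b ε C (γ t)‖ ≤ K := by
  have h := (edist_le_curveLength (hf := contMDiff_stretch_coe b ε C)
    (hinj := injective_mvfderiv_stretch_coe b hε C) γ hs ht).trans hγ
  rw [edist_dist, ENNReal.ofReal_le_ofReal_iff hK, dist_eq_norm] at h
  exact h

/-- The point of the sphere on the Veronese surface given by the vector of latitude `τ` over `z`. -/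
noncomputable def veronesePoint (hb : Orthonormal ℝ b) (τ : ℝ) (z : Circle) : UnitSphere n :=
  ⟨embed b (veronese (latLong τ z)), by
    rw [mem_sphere_zero_iff_norm, norm_embed_veronese hb]⟩

lemma formDet_coords_veronesePoint (hb : Orthonormal ℝ b) (τ : ℝ) (z : Circle) :
    formDet (coords b (veronesePoint hb τ z)) = 2 := by
  rw [veronesePoint, coords_embed hb, formDet_veronese, latLong_dotProduct_self]
  norm_num

lemma continuous_veronesePoint (hb : Orthonormal ℝ b) {T : Type*} [TopologicalSpace T]
    {τ : T → ℝ} (hτ : Continuous τ) {z : T → Circle} (hz : Continuous z) :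
    Continuous fun t => veronesePoint hb (τ t) (z t) := by
  refine Continuous.subtype_mk ?_ _
  have h1 : Continuous fun t => latLong (τ t) (z t) := by
    have : Continuous fun t => (z t : ℂ) := by fun_prop
    refine continuous_pi fun j => ?_
    fin_cases j <;> simp [latLong] <;> fun_prop
  fun_prop

lemma contMDiff_veronesePoint (hb : Orthonormal ℝ b) (τ c : ℝ) :
    ContMDiff 𝓘(ℝ, ℝ) (𝓡 n) 1 fun s : ℝ => veronesePoint hb τ (Circle.exp (c * s)) := by
  have h1 : ContDiff ℝ ∞ fun s : ℝ => latLong τ (Circle.exp (c * s)) := by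
    have h2 : ContDiff ℝ ∞ fun s : ℝ => (Circle.exp (c * s) : ℂ) := by
      simp only [Circle.coe_exp]
      have : ContDiff ℝ ∞ (fun s : ℝ => ((c * s : ℝ) : ℂ)) :=
        Complex.ofRealCLM.contDiff.comp (contDiff_const.mul contDiff_id)
      fun_prop
    have hre := Complex.reCLM.contDiff.comp h2
    have him := Complex.imCLM.contDiff.comp h2
    refine contDiff_pi.2 fun j => ?_
    fin_cases j
    · exact contDiff_const.mul hre
    · exact contDiff_const.mul him
    · exact contDiff_const
  have h3 : ContDiff ℝ ∞ fun s : ℝ => embed b (veronese (latLong τ (Circle.exp (c * s)))) := by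
    fun_prop
  have := fact_finrank_euclideanSpace n
  exact (h3.of_le (by simp)).contMDiff.codRestrict_sphere _

lemma curveLength_le_of_eq_veronesePoint (hb : Orthonormal ℝ b) {ε : ℝ} (hε : 0 < ε) (C : ℝ)
    {γ : C(UnitAddCircle, UnitSphere n)} {τ c : ℝ} (hc : 0 ≤ c)
    (hγ : ∀ s : ℝ, γ s = veronesePoint hb τ (Circle.exp (c * s))) :
    curveLength (stretchMetric b hε.ne' C) γ ≤ ENNReal.ofReal (2 * c * ε) := by
  refine curveLength_le γ hγ (contMDiff_veronesePoint hb τ c) ?_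
  refine LipschitzWith.of_dist_le_mul fun s t => ?_
  rw [dist_eq_norm, Function.comp_apply, Function.comp_apply,
    norm_stretch_sub_of_formDet_eq_two b hε.le C (formDet_coords_veronesePoint hb _ _)
      (formDet_coords_veronesePoint hb _ _), Real.coe_toNNReal _ (by positivity)]
  have h := norm_embed_veronese_sub_le hb τ (c * s) (c * t)
  rw [← mul_sub, abs_mul, abs_of_nonneg hc] at h
  rw [Real.dist_eq]
  calc ε * ‖embed b (veronese (latLong τ (Circle.exp (c * s))))
      - embed b (veronese (latLong τ (Circle.exp (c * t))))‖
      ≤ ε * (2 * (c * |s - t|)) := by gcongr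
    _ = 2 * c * ε * |s - t| := by ring

/-- A Lebesgue number for the compact set `det ≥ 1` and its cover by the regions where a given vector
is positive. -/
lemma exists_ball_polar_pos (b : Fin 5 → EuclideanSpace ℝ (Fin (n + 1))) :
    ∃ δ > 0, ∀ x : UnitSphere n, 1 ≤ formDet (coords b x) →
      ∃ w, ∀ y : UnitSphere n, dist y x < δ → 0 < polar (coords b y) w w := by
  have hcont : Continuous fun y : UnitSphere n => coords b y :=
    (continuous_coords b).comp continuous_subtype_val
  have hcpt : IsCompact {x : UnitSphere n | 1 ≤ formDet (coords b x)} :=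
    (isClosed_le continuous_const (by fun_prop)).isCompact
  obtain ⟨δ, hδ, h⟩ := lebesgue_number_lemma_of_metric hcpt
    (c := fun w : Fin 3 → ℝ => {y : UnitSphere n | 0 < polar (coords b y) w w})
    (fun w => isOpen_lt continuous_const (by fun_prop))
    (fun x hx => mem_iUnion.2 (exists_polar_pos (lt_of_lt_of_le one_pos hx)))
  exact ⟨δ, hδ, fun x hx => (h x hx).imp fun w hw y hy => hw hy⟩

/-- The image of a line of the projective plane: the Veronese image of a half turn of the equator.
As the Veronese map is even, the curve closes up; it is written in terms of the double angle. -/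
noncomputable def veroneseLine (hb : Orthonormal ℝ b) : C(UnitAddCircle, UnitSphere n) where
  toFun s := ⟨embed b ![√3 * ((AddCircle.toCircle s : ℂ).re / 2), 1 / 2,
    √3 * ((AddCircle.toCircle s : ℂ).im / 2), 0, 0], by
      have h := norm_sq_embed hb ![√3 * ((AddCircle.toCircle s : ℂ).re / 2), 1 / 2,
        √3 * ((AddCircle.toCircle s : ℂ).im / 2), 0, 0]
      have h3 : √3 ^ 2 = 3 := Real.sq_sqrt (by norm_num)
      have h1 := Circle.normSq_coe (AddCircle.toCircle s)
      rw [Complex.normSq_apply] at h1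
      simp only [Fin.sum_univ_five, Matrix.cons_val, mul_pow, h3] at h
      rw [mem_sphere_zero_iff_norm]
      refine (pow_eq_one_iff_of_nonneg (norm_nonneg _) two_ne_zero).1 (h.trans ?_)
      linear_combination (3 / 4) * h1⟩
  continuous_toFun := by
    refine Continuous.subtype_mk ((continuous_embed b).comp (continuous_pi fun j => ?_)) _
    have : Continuous fun s : UnitAddCircle => (AddCircle.toCircle s : ℂ) :=
      continuous_subtype_val.comp AddCircle.continuous_toCircle
    fin_cases j <;> simp <;> fun_prop

lemma veronese_latLong_zero (z : ℂ) (hz : Complex.normSq z = 1) :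
    veronese (latLong 0 z) = ![√3 * ((z ^ 2).re / 2), 1 / 2, √3 * ((z ^ 2).im / 2), 0, 0] := by
  rw [Complex.normSq_apply] at hz
  ext j
  fin_cases j <;> simp [veronese, latLong, sq]
  · linarith
  · ring

lemma veroneseLine_coe (hb : Orthonormal ℝ b) (s : ℝ) :
    veroneseLine hb (s : UnitAddCircle) = veronesePoint hb 0 (Circle.exp (Real.pi * s)) := by
  have h : (AddCircle.toCircle (s : UnitAddCircle)) = Circle.exp (Real.pi * s) ^ 2 := by
    rw [AddCircle.toCircle_apply_mk, sq, ← Circle.exp_add]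
    congr 1; ring
  apply Subtype.ext
  simp only [veroneseLine, veronesePoint, ContinuousMap.coe_mk]
  rw [veronese_latLong_zero _ (Circle.normSq_coe _), h, Circle.coe_pow]

lemma doubleCurve_veroneseLine (hb : Orthonormal ℝ b) (s : UnitAddCircle) :
    doubleCurve (veroneseLine hb) s = veronesePoint hb 0 (AddCircle.toCircle s) := by
  induction s using QuotientAddGroup.induction_on with
  | H s =>
    have h : (2 • (s : UnitAddCircle)) = ((2 * s : ℝ) : UnitAddCircle) := by
      rw [two_nsmul, two_mul, AddCircle.coe_add]
    change veroneseLine hb (2 • (s : UnitAddCircle)) = _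
    rw [h, veroneseLine_coe, AddCircle.toCircle_apply_mk]
    congr 2; ring

/-- The line traversed twice is the image of the full equator, which contracts over the pole. -/
noncomputable def contraction (hb : Orthonormal ℝ b) : (doubleCurve (veroneseLine hb)).Homotopy
    (ContinuousMap.const _ (veronesePoint hb (Real.pi / 2) 1)) where
  toFun p := veronesePoint hb (Real.pi / 2 * p.1) (AddCircle.toCircle p.2)
  continuous_toFun := continuous_veronesePoint hb (by fun_prop)
    (AddCircle.continuous_toCircle.comp continuous_snd)
  map_zero_left s := by simp [doubleCurve_veroneseLine]
  map_one_left s := by simp [veronesePoint, latLong]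

/-- The half turn of the equator is a section over the line; it ends at the antipode of its origin. -/
lemma isOdd_veroneseLine (hb : Orthonormal ℝ b) :
    IsOdd fun s : ℝ => coords b (veroneseLine hb (s : UnitAddCircle)) := by
  have hA : ∀ s : ℝ, coords b (veroneseLine hb (s : UnitAddCircle)) =
      veronese (latLong 0 (Circle.exp (Real.pi * s))) := fun s => by
    rw [veroneseLine_coe, veronesePoint, coords_embed hb]
  refine ⟨fun s => latLong 0 (Circle.exp (Real.pi * s)), ⟨?_, fun s _ => ?_⟩, ?_⟩
  · have : Continuous fun s : ℝ => (Circle.exp (Real.pi * s) : ℂ) := by fun_prop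
    refine continuous_pi fun j => ?_
    fin_cases j <;> simp [latLong] <;> fun_prop
  · beta_reduce
    rw [hA, polar_veronese, latLong_dotProduct_self]
    norm_num
  · beta_reduce
    rw [hA, polar_veronese, latLong_dotProduct_self, latLong_dotProduct]
    simp

/-- Loops of length at most `K` cannot leave the region `det > 1` while staying odd: one that meets the
level `det = 1` lies in a ball of radius `δ`, and so is even. Hence every loop in the homotopy class
is odd and leaves the balls of radius `δ`, so its length is at least of order `ε δ`. -/
lemma minLength_veroneseLine_pos (hb : Orthonormal ℝ b) {ε δ K : ℝ} (hε : 0 < ε) (hδ : 0 < δ)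
    (hK : 0 < K) (hball : ∀ x : UnitSphere n, 1 ≤ formDet (coords b x) →
      ∃ w, ∀ y : UnitSphere n, dist y x < δ → 0 < polar (coords b y) w w) :
    0 < minLength (stretchMetric b hε.ne' (4 * K / δ)) K (veroneseLine hb) := by
  refine lt_of_lt_of_le (ENNReal.ofReal_pos.2 (mul_pos hε (half_pos hδ))) (le_iInf₂ ?_)
  rintro β ⟨F, hF⟩
  have hC : 0 < 4 * K / δ := by positivity
  let A : unitInterval → ℝ → Fin 5 → ℝ := fun t s => coords b (F (t, (s : UnitAddCircle)))
  have hA : Continuous (Function.uncurry A) := by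
    refine (continuous_coords b).comp (continuous_subtype_val.comp (F.continuous.comp ?_))
    exact continuous_fst.prodMk ((AddCircle.continuous_mk' (1 : ℝ)).comp continuous_snd)
  have hper : ∀ t, A t 0 = A t 1 := fun t => by
    have : ((1 : ℝ) : UnitAddCircle) = ((0 : ℝ) : UnitAddCircle) := by
      simp [AddCircle.coe_period]
    simp only [A, this]
  have hA0 : A 0 = fun s : ℝ => coords b (veroneseLine hb (s : UnitAddCircle)) := by
    ext1 s; simp [A]
  have hA1 : ∀ s, A 1 s = coords b (β (s : UnitAddCircle)) := fun s => by simp [A]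
  obtain ⟨hodd, hdisc⟩ := isOdd_of_homotopy hA hper (hA0 ▸ isOdd_veroneseLine hb)
    (fun s _ => by
      rw [hA0]
      simp only [veroneseLine_coe, formDet_coords_veronesePoint]
      norm_num)
    (fun t ht => by
      obtain ⟨s₀, hs₀, hdisc⟩ := ht
      obtain ⟨w, hw⟩ := hball (F (t, (s₀ : UnitAddCircle))) hdisc.ge
      refine ⟨w, fun s hs => hw _ ?_⟩
      have h1 := norm_stretch_sub_le_of_curveLength_le hε.ne' (4 * K / δ) hK.le (hF t) hs₀ hs
      have h2 := norm_sub_le_of_formDet_eq_one b ε hC.le (x := F (t, (s₀ : UnitAddCircle)))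
        (y := F (t, (s : UnitAddCircle))) (norm_eq_of_mem_sphere _) (norm_eq_of_mem_sphere _) hdisc
      have h3 := h2.trans (mul_le_mul_of_nonneg_left h1 two_pos.le)
      rw [dist_comm, Subtype.dist_eq, dist_eq_norm]
      rw [div_mul_eq_mul_div, div_le_iff₀ hδ] at h3
      nlinarith) 1
  by_contra! hlt
  obtain ⟨w, hw⟩ := hball (β ((0 : ℝ) : UnitAddCircle)) (hA1 0 ▸ (hdisc 0 (by simp)).le)
  refine hodd.not_forall_polar_pos (by fun_prop) (hper 1)
    (fun s hs => one_pos.trans (hdisc s hs)) w fun s hs => ?_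
  rw [hA1]
  apply hw
  have h1 := norm_stretch_sub_le_of_curveLength_le hε.ne' (4 * K / δ)
    (mul_pos hε (half_pos hδ)).le hlt.le hs (by simp : (0 : ℝ) ∈ Icc (0 : ℝ) 1)
  have h2 := (norm_sub_le_norm_stretch_sub b hε.le _ _ _).trans h1
  rw [Subtype.dist_eq, dist_eq_norm]
  have h3 := le_of_mul_le_mul_left h2 hε
  linarith

end Sphere

theorem mainTheorem6 (n : ℕ) (hn : 4 ≤ n) (K L : ℝ) (hL : 0 < L) (hLK : L < K) :
    ∃ (g : Bundle.ContMDiffRiemannianMetric (𝓡 n) ∞ (EuclideanSpace ℝ (Fin n))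
        (fun x : Metric.sphere (0 : EuclideanSpace ℝ (Fin (n + 1))) 1 => TangentSpace (𝓡 n) x))
      (α : C(UnitAddCircle, Metric.sphere (0 : EuclideanSpace ℝ (Fin (n + 1))) 1)),
      curveLength g (doubleCurve α) ≤ ENNReal.ofReal L ∧
      curveLength g α ≤ ENNReal.ofReal K ∧
      minLength g L (doubleCurve α) = 0 ∧
      0 < minLength g K α := by
  obtain ⟨b, hb⟩ : ∃ b : Fin 5 → EuclideanSpace ℝ (Fin (n + 1)), Orthonormal ℝ b :=
    ⟨_, (EuclideanSpace.basisFun (Fin (n + 1)) ℝ).orthonormal.comp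
      (Fin.castLE (by omega : 5 ≤ n + 1)) (Fin.castLE_injective _)⟩
  obtain ⟨δ, hδ, hball⟩ := exists_ball_polar_pos b
  -- `ε = L / 4π`, because the contracted equator is `2`-Lipschitz in the angle, over a full turn;
  -- `C = 4 K / δ` makes loops of length at most `K` through the level `det = 1` smaller than `δ`
  have hπ := Real.pi_pos
  have hε : 0 < L / (4 * Real.pi) := by positivity
  have hεL : 2 * (2 * Real.pi) * (L / (4 * Real.pi)) = L := by field_simp; norm_num
  have hlen : ∀ t : unitInterval, curveLength (stretchMetric b hε.ne' (4 * K / δ))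
      ((contraction hb).curry t) ≤ ENNReal.ofReal L := fun t => by
    refine (curveLength_le_of_eq_veronesePoint hb hε _ (τ := Real.pi / 2 * t)
      (c := 2 * Real.pi) (by positivity) fun s => ?_).trans (ENNReal.ofReal_le_ofReal hεL.le)
    change veronesePoint hb _ (AddCircle.toCircle (s : UnitAddCircle)) = _
    rw [AddCircle.toCircle_apply_mk, div_one]
  refine ⟨stretchMetric b hε.ne' (4 * K / δ), veroneseLine hb, ?_, ?_, ?_,
    minLength_veroneseLine_pos hb hε hδ (hL.trans hLK) hball⟩
  · have h : (contraction hb).curry 0 = doubleCurve (veroneseLine hb) := by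
      ext1 s
      exact (contraction hb).map_zero_left s
    exact h ▸ hlen 0
  · refine (curveLength_le_of_eq_veronesePoint hb hε _ Real.pi_pos.le
      (veroneseLine_coe hb)).trans (ENNReal.ofReal_le_ofReal ?_)
    nlinarith
  · refine le_antisymm ?_ zero_le
    refine (iInf₂_le (ContinuousMap.const _ (veronesePoint hb (Real.pi / 2) 1))
      ⟨contraction hb, hlen⟩).trans_eq ?_
    exact curveLength_const _
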